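/- Let $p\neq q$ be odd primes with $\gcd(p-1,q-1)=4$, $q\equiv 1\pmod 8$ and $p\equiv 5\pmod 8$, and put $e=(p-1)(q-1)/4$. Let $g$ be an integer that is a primitive root both modulo $p$ and modulo $q$, and let $h$ be an integer with $h\equiv g\pmod p$ and $h\equiv 1\pmod q$. For $0\le i<4$ let $$D_i=\{g^{4s+i}h^j \bmod pq : 0\le s<e/4,\ 0\le j<4\}\subseteq \mathbb{Z}_{pq},$$ so that $\mathbb{Z}_{pq}^*$ is the disjoint union of $D_0,D_1,D_2,D_3$. Let $P=\{p,2p,\dots,(q-1)p\}$ and $Q=\{q,2q,\dots,(p-1)q\}$, and let $(e_u)_{u\ge 0}$ be the sequence over $\mathbb{Z}_4$ given by $$e_u=\begin{cases}2,& u \bmod pq\in Q\cup\{0\},\\ 0,& u\bmod pq\in P,\\ i,& u\bmod pq\in D_i,\ i=0,1,2,3.\end{cases}$$ The linear complexity $L((e_u))$ is the length of the shortest linear feedback shift register over $\mathbb{Z}_4$ generating $(e_u)$, i.e. the least $L\ge 0$ for which there are $c_0,\dots,c_{L-1}\in\mathbb{Z}_4$ with $e_{u+L}=\sum_{i=0}^{L-1}c_i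 e_{u+i}$ for all $u\ge 0$. Then $2\in D_0\cup D_2$, and $$L((e_u))=\begin{cases} q+\dfrac{3(p-1)(q-1)}{4},& \text{if } 2\in D_0,\\[1ex] pq-p+1,& \text{if } 2\in D_2.\end{cases}$$ -/

import Mathlib

/-- The number `e = (p - 1) (q - 1) / 4`
(an exact quotient whenever `gcd (p - 1) (q - 1) = 4`). -/
def DingHelleseth.e (p q : ℕ) : ℕ := (p - 1) * (q - 1) / 4

/-- The generalized cyclotomic class
`D_i = { g ^ (4 s + i) * h ^ j mod p q : 0 ≤ s < e / 4, 0 ≤ j < 4 }`. -/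
def DingHelleseth.D (p q : ℕ) (g h : ℤ) (i : ℕ) : Set (ZMod (p * q)) :=
  {x | ∃ s j : ℕ, s < DingHelleseth.e p q / 4 ∧ j < 4 ∧
    x = (g : ZMod (p * q)) ^ (4 * s + i) * (h : ZMod (p * q)) ^ j}

/-- `P = {p, 2 p, …, (q - 1) p}`, as a set of residues modulo `p q`. -/
def DingHelleseth.P (p q : ℕ) : Set (ZMod (p * q)) :=
  {x | ∃ k : ℕ, 1 ≤ k ∧ k < q ∧ x = ((k * p : ℕ) : ZMod (p * q))}

/-- `Q = {q, 2 q, …, (p - 1) q}`, as a set of residues modulo `p q`. -/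
def DingHelleseth.Q (p q : ℕ) : Set (ZMod (p * q)) :=
  {x | ∃ k : ℕ, 1 ≤ k ∧ k < p ∧ x = ((k * q : ℕ) : ZMod (p * q))}

open Classical in
/-- The quaternary sequence: `2` on `Q ∪ {0}`, `0` on `P`, and `i` on `D_i` for `i = 0, 1, 2, 3`.
These sets partition the residues modulo `p q`, so the last branch is never reached when `p`, `q`,
`g`, `h` are as in the construction. -/
noncomputable def DingHelleseth.seq (p q : ℕ) (g h : ℤ) (u : ℕ) : ZMod 4 :=
  if (u : ZMod (p * q)) ∈ DingHelleseth.Q p q ∪ {0} then 2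
  else if (u : ZMod (p * q)) ∈ DingHelleseth.P p q then 0
  else if (u : ZMod (p * q)) ∈ DingHelleseth.D p q g h 0 then 0
  else if (u : ZMod (p * q)) ∈ DingHelleseth.D p q g h 1 then 1
  else if (u : ZMod (p * q)) ∈ DingHelleseth.D p q g h 2 then 2
  else if (u : ZMod (p * q)) ∈ DingHelleseth.D p q g h 3 then 3
  else 0

/-- The linear complexity of a sequence over `R`: the least length of a linear feedback shift
register over `R` generating it, i.e. the least `L` such that, for some `c_0, …, c_{L-1}` in `R`,
`s (u + L) = ∑ i, c_i * s (u + i)` for all `u`. (A periodic sequence always satisfies such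
a recurrence, so the infimum is over a nonempty set.) -/
noncomputable def linearComplexity {R : Type*} [CommSemiring R] (s : ℕ → R) : ℕ :=
  sInf {L : ℕ | ∃ E : LinearRecurrence R, E.order = L ∧ E.IsSolution s}

/-! For a sequence over `ZMod 4` of odd period `N`, the linear complexity is the number of nonzero
Fourier coefficients, computed in the length-two Witt vectors of an algebraic closure of `F_2` with
a Teichmüller `N`-th root of unity (`quaternaryDFT.linearComplexity_eq`). A coefficient may be a
zero divisor, but it still forces a root in the residue field.

Let `t` be the logarithm mod 4 on `ZMod q`, with `t 0 = 0`. Under `ZMod (p * q) ≃ ZMod p × ZMod q`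
the sequence is `2·[y = 0] + [x ≠ 0]·t y`. As `p ≡ 1 mod 4`, its transform at `(a, b)` is `2` if `a
= 0` and minus the transform `T b` of `t` otherwise. Hence `L = p q - (p - 1) Z`, where `Z` counts
the zeros of `T`.

Since `8 ∣ q - 1`, `T 0 = 0`; for `w ≠ 0`, `T w = T 1 + t w`, and Frobenius sends `T w` to `T (2
w)`. If `t 2 = 0`, then `T 1` is Frobenius-fixed, hence a constant of `ZMod 4`, and `T` vanishes at
0 and on one class of size `(q - 1) / 4`. If `t 2 ≠ 0`, a zero `w ≠ 0` would give `t 2 = 0`, so `Z =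
1`. Finally 2 is a square mod `q`, so `t 2` is 0 or 2. -/

/-! ### Rings with a Frobenius lift, and their construction from Witt vectors -/

/-- A ring `R` over `ZMod 4` with a map `φ` to a field whose kernel is both `2R` and the
annihilator of `2`, and with an endomorphism `σ` lifting the Frobenius of that field. -/
structure IsFrobeniusLift {R k : Type*} [CommRing R] [Field k] [Algebra (ZMod 4) R]
    (φ : R →+* k) (σ : R →+* R) : Prop where
  exists_eq_two_mul : ∀ x, φ x = 0 → ∃ y, x = 2 * y
  map_eq_zero_of_two_mul_eq_zero : ∀ x, 2 * x = 0 → φ x = 0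
  map_apply : ∀ x, φ (σ x) = φ x ^ 2

namespace IsFrobeniusLift

variable {R k : Type*} [CommRing R] [Field k] [Algebra (ZMod 4) R] {φ : R →+* k} {σ : R →+* R}

theorem four_eq_zero (R : Type*) [CommRing R] [Algebra (ZMod 4) R] : (4 : R) = 0 := by
  have := congrArg (algebraMap (ZMod 4) R) (show (4 : ZMod 4) = 0 by decide)
  simpa only [map_ofNat, map_zero] using this

theorem two_mul_eq_zero_iff (H : IsFrobeniusLift φ σ) (x : R) : 2 * x = 0 ↔ φ x = 0 := by
  refine ⟨H.map_eq_zero_of_two_mul_eq_zero x, fun h ↦ ?_⟩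
  obtain ⟨y, rfl⟩ := H.exists_eq_two_mul x h
  linear_combination y * four_eq_zero R

/-- Replaces the domain property: elements outside the kernel of `φ` are not zero divisors. -/
theorem map_eq_zero_of_mul_eq_zero (H : IsFrobeniusLift φ σ) {x y : R} (h : x * y = 0)
    (hy : y ≠ 0) : φ x = 0 := by
  by_contra hx
  have h1 : φ x * φ y = 0 := by rw [← map_mul, h, map_zero]
  obtain ⟨z, rfl⟩ := H.exists_eq_two_mul y ((mul_eq_zero.1 h1).resolve_left hx)
  have h2 : φ (x * z) = 0 := H.map_eq_zero_of_two_mul_eq_zero _ (by linear_combination h)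
  rw [map_mul, mul_eq_zero] at h2
  exact hy ((H.two_mul_eq_zero_iff z).2 (h2.resolve_left hx))

theorem injective (H : IsFrobeniusLift φ σ) : Function.Injective σ := by
  refine (injective_iff_map_eq_zero σ).2 fun x hx ↦ ?_
  have h0 : ∀ y, φ (σ y) = 0 → φ y = 0 := fun y hy ↦ by
    rw [H.map_apply] at hy
    exact pow_eq_zero_iff two_ne_zero |>.1 hy
  obtain ⟨y, rfl⟩ := H.exists_eq_two_mul x (h0 x (by rw [hx, map_zero]))
  rw [map_mul, map_ofNat] at hx
  exact (H.two_mul_eq_zero_iff y).2 (h0 y ((H.two_mul_eq_zero_iff _).1 hx))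

theorem algebraMap_injective (H : IsFrobeniusLift φ σ) :
    Function.Injective (algebraMap (ZMod 4) R) := by
  have : Nontrivial R := φ.domain_nontrivial
  have h2 : (2 : R) ≠ 0 := fun h ↦ one_ne_zero (α := k) <| by
    rw [← map_one φ]
    exact H.map_eq_zero_of_two_mul_eq_zero 1 (by rw [mul_one, h])
  refine (injective_iff_map_eq_zero _).2 fun c hc ↦ ?_
  have hcases : c = 0 ∨ c = 1 ∨ c = 2 ∨ c = 3 := by clear hc; revert c; decide
  rcases hcases with rfl | rfl | rfl | rfl
  · rfl
  · simp at hc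
  · rw [map_ofNat] at hc
    exact absurd hc h2
  · rw [map_ofNat] at hc
    exact absurd (show (1 : R) = 0 by linear_combination four_eq_zero R - hc) one_ne_zero

/-- The elements fixed by the Frobenius lift are exactly the constants. -/
theorem exists_algebraMap_eq (H : IsFrobeniusLift φ σ) {x : R} (hx : σ x = x) :
    ∃ c, algebraMap (ZMod 4) R c = x := by
  -- Solutions of `y² = y` in the field are 0 and 1. This is used for both binary digits: of `x`,
  -- then of `y` where `x = c + 2 y`.
  have key : ∀ y, φ (σ y) = φ y → ∃ c : ZMod 4, ∃ z, y = algebraMap (ZMod 4) R c + 2 * z := by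
    intro y hy
    rw [H.map_apply] at hy
    have h01 : φ y * (φ y - 1) = 0 := by linear_combination hy
    rcases mul_eq_zero.1 h01 with h | h
    · obtain ⟨z, hz⟩ := H.exists_eq_two_mul y h
      exact ⟨0, z, by rw [hz, map_zero, zero_add]⟩
    · obtain ⟨z, hz⟩ := H.exists_eq_two_mul (y - 1) (by rw [map_sub, map_one, h])
      exact ⟨1, z, by rw [map_one]; linear_combination hz⟩
  have hc : ∀ c, σ (algebraMap (ZMod 4) R c) = algebraMap (ZMod 4) R c := fun c ↦
    RingHom.congr_fun (RingHom.ext_zmod (σ.comp (algebraMap (ZMod 4) R)) _) c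
  obtain ⟨c, y, hy⟩ := key x (by rw [hx])
  have h1 : 2 * (σ y - y) = 0 := by
    have := hx
    rw [hy, map_add, hc, map_mul, map_ofNat] at this
    linear_combination this
  obtain ⟨d, z, hz⟩ := key y (by
    rw [← sub_eq_zero, ← map_sub]
    exact H.map_eq_zero_of_two_mul_eq_zero _ h1)
  refine ⟨c + 2 * d, ?_⟩
  rw [hy, hz, map_add, map_mul, map_ofNat]
  linear_combination -z * four_eq_zero R

/-- Multiplying the sum by `χ v` only permutes it. As `R` is not a domain, `χ v - 1` must be nonzero
in the residue field, hence injectivity of `φ ∘ χ`. -/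
theorem sum_addChar_mul (H : IsFrobeniusLift φ σ) {n : ℕ} [NeZero n] {χ : AddChar (ZMod n) R}
    (hχ : Function.Injective fun a ↦ φ (χ a)) (v : ZMod n) :
    ∑ a, χ (a * v) = if v = 0 then (n : R) else 0 := by
  split_ifs with hv
  · simp [hv, AddChar.map_zero_eq_one, ZMod.card]
  · by_contra hS
    have h : (χ v - 1) * ∑ a, χ (a * v) = 0 := by
      rw [sub_mul, one_mul, sub_eq_zero, Finset.mul_sum]
      refine Fintype.sum_equiv (Equiv.addRight 1) _ _ fun a ↦ ?_
      rw [← AddChar.map_add_eq_mul, Equiv.coe_addRight]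
      congr 1
      ring
    have h1 := H.map_eq_zero_of_mul_eq_zero h hS
    rw [map_sub, sub_eq_zero] at h1
    exact hv (hχ (by simpa using h1))

end IsFrobeniusLift

/-- The Witt vectors of length two over an algebraic closure of the field with two elements, together
with Teichmüller lifts of roots of unity. -/
theorem exists_isFrobeniusLift (N : ℕ) [NeZero N] (hN : Odd N) :
    ∃ (R k : Type) (_ : CommRing R) (_ : Field k) (_ : Algebra (ZMod 4) R) (φ : R →+* k)
      (σ : R →+* R) (ψ : AddChar (ZMod N) R), IsFrobeniusLift φ σ ∧
        (Function.Injective fun a ↦ φ (ψ a)) ∧ ∀ a, σ (ψ a) = ψ (2 * a) := by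
  have : Fact (Nat.Prime 2) := ⟨Nat.prime_two⟩
  let k := AlgebraicClosure (ZMod 2)
  have hNk : NeZero (N : k) := ⟨fun h ↦ by
    rw [CharP.cast_eq_zero_iff k 2] at h
    exact (Nat.not_even_iff_odd.2 hN) (even_iff_two_dvd.2 h)⟩
  have : NeZero (N : ZMod 2) := ⟨fun h ↦ by
    rw [CharP.cast_eq_zero_iff (ZMod 2) 2] at h
    exact (Nat.not_even_iff_odd.2 hN) (even_iff_two_dvd.2 h)⟩
  let W := WittVector 2 k
  let I : Ideal W := Ideal.span {(4 : W)}
  have h4 : ∀ x : W, x ∈ I ↔ ∃ y, x = 4 * y := fun x ↦ by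
    rw [Ideal.mem_span_singleton]; rfl
  -- `x` is a Verschiebung of its shift; Frobenius is surjective over a perfect field, and `V F =
  -- 2`.
  have hker : ∀ x : W, WittVector.constantCoeff x = 0 → ∃ y : W, x = 2 * y := by
    intro x hx
    have h1 := WittVector.verschiebung_shift x 0 (by
      intro i hi
      obtain rfl : i = 0 := by omega
      exact hx)
    obtain ⟨z, hz⟩ := (WittVector.frobeniusEquiv 2 k).surjective (x.shift 1)
    refine ⟨z, ?_⟩
    have h2 := WittVector.verschiebung_frobenius (p := 2) z
    rw [WittVector.frobeniusEquiv_apply] at hz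
    rw [hz] at h2
    rw [mul_comm] at h2
    have h3 : x.shift 0 = x := by
      ext n
      rw [WittVector.shift_coeff, zero_add]
    simpa [h3] using h1.symm.trans h2
  have hcc2 : WittVector.constantCoeff (2 : W) = (0 : k) := by
    rw [map_ofNat]; exact CharTwo.two_eq_zero
  have h20 : (2 : W) ≠ 0 := by
    have := (WittVector.irreducible (p := 2) (k := k)).ne_zero
    exact_mod_cast this
  let φ : W ⧸ I →+* k := Ideal.Quotient.lift I WittVector.constantCoeff fun x hx ↦ by
    obtain ⟨y, rfl⟩ := (h4 x).1 hx
    rw [show (4 : W) = 2 * 2 by norm_num, map_mul, map_mul, hcc2, zero_mul, zero_mul]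
  let σ : W ⧸ I →+* W ⧸ I :=
    Ideal.quotientMap I (WittVector.frobenius : W →+* W) fun x hx ↦ by
      obtain ⟨y, rfl⟩ := (h4 x).1 hx
      rw [Ideal.mem_comap, map_mul, map_ofNat]
      exact (h4 _).2 ⟨_, rfl⟩
  have hI4 : (4 : W ⧸ I) = 0 := by
    have := Ideal.Quotient.eq_zero_iff_mem.2 ((h4 4).2 ⟨1, (mul_one _).symm⟩)
    simpa only [map_ofNat] using this
  obtain ⟨c, hc⟩ := CharP.exists (W ⧸ I)
  have hc4 : c ∣ 4 := (CharP.cast_eq_zero_iff (W ⧸ I) c 4).1 (by exact_mod_cast hI4)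
  let ι : ZMod 4 →+* W ⧸ I := ZMod.castHom hc4 (W ⧸ I)
  obtain ⟨ζ, hζ⟩ := HasEnoughRootsOfUnity.exists_primitiveRoot k N
  let ψk : AddChar (ZMod N) k := AddChar.zmodChar N hζ.pow_eq_one
  let τ : k →* W ⧸ I := (Ideal.Quotient.mk I).toMonoidHom.comp (WittVector.teichmuller 2)
  refine ⟨W ⧸ I, k, inferInstance, inferInstance, ι.toAlgebra, φ, σ, τ.compAddChar ψk,
    @IsFrobeniusLift.mk _ _ _ _ (_) _ _ ?_ ?_ ?_, ?_, ?_⟩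
  · intro x
    obtain ⟨x, rfl⟩ := Ideal.Quotient.mk_surjective x
    intro hx
    obtain ⟨y, rfl⟩ := hker x hx
    exact ⟨Ideal.Quotient.mk I y, by rw [map_mul, map_ofNat]⟩
  · intro x
    obtain ⟨x, rfl⟩ := Ideal.Quotient.mk_surjective x
    intro hx
    rw [← map_ofNat (Ideal.Quotient.mk I) 2, ← map_mul, Ideal.Quotient.eq_zero_iff_mem, h4] at hx
    obtain ⟨y, hy⟩ := hx
    obtain rfl : x = 2 * y := mul_left_cancel₀ h20 (by rw [hy]; ring)
    change WittVector.constantCoeff (2 * y) = 0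
    rw [map_mul, hcc2, zero_mul]
  · intro x
    obtain ⟨x, rfl⟩ := Ideal.Quotient.mk_surjective x
    exact WittVector.coeff_frobenius_charP 2 x 0
  · intro a b hab
    have h : ψk a = ψk b := by
      have : ∀ c, φ (τ.compAddChar ψk c) = ψk c := fun c ↦ WittVector.teichmuller_coeff_zero 2 _
      simpa only [this] using hab
    rw [AddChar.zmodChar_apply, AddChar.zmodChar_apply] at h
    exact ZMod.val_injective N (hζ.pow_inj (ZMod.val_lt a) (ZMod.val_lt b) h)
  · intro a
    have h : ψk (2 * a) = ψk a ^ 2 := by rw [two_mul, AddChar.map_add_eq_mul, sq]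
    change Ideal.Quotient.mk I (WittVector.frobenius (WittVector.teichmuller 2 (ψk a))) =
      Ideal.Quotient.mk I (WittVector.teichmuller 2 (ψk (2 * a)))
    rw [WittVector.frobenius_eq_map_frobenius, WittVector.map_teichmuller, h]
    rfl

/-! ### Fourier transform and linear complexity -/

/-- The discrete Fourier transform of a sequence over `ZMod 4` of period `N`. -/
noncomputable def quaternaryDFT {R : Type*} [CommRing R] [Algebra (ZMod 4) R] {N : ℕ} [NeZero N]
    (ψ : AddChar (ZMod N) R) (s : ZMod N → ZMod 4) (v : ZMod N) : R :=
  ∑ u, algebraMap (ZMod 4) R (s u) * ψ (u * v)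

namespace quaternaryDFT

variable {R k : Type*} [CommRing R] [Field k] [Algebra (ZMod 4) R] {φ : R →+* k} {σ : R →+* R}
  {N : ℕ} [NeZero N] {ψ : AddChar (ZMod N) R}

theorem sum_shift (s : ZMod N → ZMod 4) (j : ℕ) (v : ZMod N) :
    ∑ u, algebraMap (ZMod 4) R (s (u + j)) * ψ (u * v) = ψ (-v) ^ j * quaternaryDFT ψ s v := by
  rw [quaternaryDFT, Finset.mul_sum]
  refine Fintype.sum_equiv (Equiv.addRight (j : ZMod N)) _ _ fun u ↦ ?_
  rw [Equiv.coe_addRight, ← AddChar.map_nsmul_eq_pow, mul_left_comm, ← AddChar.map_add_eq_mul]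
  congr 2
  rw [nsmul_eq_mul]
  ring

theorem inversion (H : IsFrobeniusLift φ σ) (hψ : Function.Injective fun a ↦ φ (ψ a))
    (s : ZMod N → ZMod 4) (w : ZMod N) :
    ∑ v, quaternaryDFT ψ s v * ψ (-v * w) = N * algebraMap (ZMod 4) R (s w) := by
  simp only [quaternaryDFT, Finset.sum_mul]
  rw [Finset.sum_comm]
  have : ∀ u, ∑ v, algebraMap (ZMod 4) R (s u) * ψ (u * v) * ψ (-v * w) =
      if u = w then N * algebraMap (ZMod 4) R (s u) else 0 := by
    intro u
    have h : ∀ v, algebraMap (ZMod 4) R (s u) * ψ (u * v) * ψ (-v * w) =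
        algebraMap (ZMod 4) R (s u) * ψ (v * (u - w)) := fun v ↦ by
      rw [mul_assoc, ← AddChar.map_add_eq_mul]
      congr 2
      ring
    simp only [h, ← Finset.mul_sum, H.sum_addChar_mul hψ, sub_eq_zero]
    split_ifs <;> ring
  rw [Finset.sum_congr rfl fun u _ ↦ this u]
  simp

theorem map_frobenius (hσ : ∀ a, σ (ψ a) = ψ (2 * a)) (s : ZMod N → ZMod 4) (v : ZMod N) :
    σ (quaternaryDFT ψ s v) = quaternaryDFT ψ s (2 * v) := by
  rw [quaternaryDFT, quaternaryDFT, map_sum]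
  refine Finset.sum_congr rfl fun u _ ↦ ?_
  rw [map_mul, hσ, mul_left_comm]
  congr 1
  exact RingHom.congr_fun (RingHom.ext_zmod (σ.comp (algebraMap (ZMod 4) R)) _) (s u)

open Classical in
theorem card_support_le_order (H : IsFrobeniusLift φ σ) (hψ : Function.Injective fun a ↦ φ (ψ a))
    (s : ZMod N → ZMod 4) (E : LinearRecurrence (ZMod 4)) (hE : E.IsSolution fun n : ℕ ↦ s n) :
    (Finset.univ.filter fun v ↦ quaternaryDFT ψ s v ≠ 0).card ≤ E.order := by
  have hs : ∀ u : ZMod N, s (u + (E.order : ℕ)) = ∑ i, E.coeffs i * s (u + (i : ℕ)) := fun u ↦ by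
    have := hE u.val
    simpa using this
  have : Nontrivial (ZMod 4) := ⟨0, 1, by decide⟩
  -- Transforming the recurrence gives `charPoly(ψ(-v))` times the coefficient at `v` equal to 0.
  -- Distinct `v` give distinct roots in the field `k`, where a degree bounds the number of roots.
  have hroot : ∀ v, quaternaryDFT ψ s v ≠ 0 →
      φ (E.charPoly.eval₂ (algebraMap (ZMod 4) R) (ψ (-v))) = 0 := by
    intro v hv
    refine H.map_eq_zero_of_mul_eq_zero ?_ hv
    rw [LinearRecurrence.charPoly, Polynomial.eval₂_sub, Polynomial.eval₂_finsetSum]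
    simp only [Polynomial.eval₂_monomial, map_one, one_mul, sub_mul, Finset.sum_mul, mul_assoc]
    simp only [← sum_shift, sub_eq_zero, Finset.mul_sum]
    rw [Finset.sum_comm]
    refine Finset.sum_congr rfl fun u _ ↦ ?_
    simp only [hs u, map_sum, map_mul, Finset.sum_mul, mul_assoc]
  have hdeg : (E.charPoly.map (φ.comp (algebraMap (ZMod 4) R))).natDegree = E.order := by
    rw [E.charPoly_monic.natDegree_map]
    exact Polynomial.natDegree_eq_of_degree_eq_some E.charPoly_degree_eq_order
  have hne : E.charPoly.map (φ.comp (algebraMap (ZMod 4) R)) ≠ 0 := (E.charPoly_monic.map _).ne_zero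
  rw [← hdeg, ← Finset.card_image_of_injective (f := fun v ↦ φ (ψ (-v))) _
    (hψ.comp neg_injective)]
  refine Polynomial.card_le_degree_of_subset_roots fun x hx ↦ ?_
  obtain ⟨v, hv, rfl⟩ := Finset.mem_image.1 (Finset.mem_def.2 hx)
  rw [Polynomial.mem_roots hne, Polynomial.IsRoot.def, Polynomial.eval_map,
    ← Polynomial.hom_eval₂]
  exact hroot v (Finset.mem_filter.1 hv).2

open Classical in
theorem exists_isSolution (H : IsFrobeniusLift φ σ) (hN : Odd N)
    (hψ : Function.Injective fun a ↦ φ (ψ a)) (hσ : ∀ a, σ (ψ a) = ψ (2 * a))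
    (s : ZMod N → ZMod 4) :
    ∃ E : LinearRecurrence (ZMod 4),
      E.order = (Finset.univ.filter fun v ↦ quaternaryDFT ψ s v ≠ 0).card ∧
        E.IsSolution fun n : ℕ ↦ s n := by
  set V := Finset.univ.filter fun v ↦ quaternaryDFT ψ s v ≠ 0 with hV
  have hnt : Nontrivial R := φ.domain_nontrivial
  let f : Polynomial R := ∏ v ∈ V, (Polynomial.X - Polynomial.C (ψ (-v)))
  have hf : f.Monic := Polynomial.monic_prod_of_monic _ _ fun v _ ↦ Polynomial.monic_X_sub_C _
  have hfd : f.natDegree = V.card := by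
    rw [Polynomial.natDegree_prod_of_monic _ _ fun v _ ↦ Polynomial.monic_X_sub_C _]
    simp
  have h2 : IsUnit (2 : ZMod N) := by
    exact_mod_cast (ZMod.isUnit_iff_coprime 2 N).2 (Nat.coprime_two_left.2 hN)
  -- Frobenius permutes the support by `v ↦ 2 v`, so `f` descends to `ZMod 4`.
  have hfσ : f.map σ = f := by
    simp only [f, Polynomial.map_prod, Polynomial.map_sub, Polynomial.map_X, Polynomial.map_C, hσ]
    refine Finset.prod_bijective (2 * ·) h2.unit.mulLeft_bijective (fun v ↦ ?_) fun v _ ↦ ?_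
    · simp only [hV, Finset.mem_filter, Finset.mem_univ, true_and, ← map_frobenius hσ, ne_eq,
        map_eq_zero_iff σ H.injective]
    · rw [mul_neg]
  have hlift : f ∈ Polynomial.lifts (algebraMap (ZMod 4) R) := by
    rw [Polynomial.lifts_iff_coeff_lifts]
    intro n
    exact H.exists_algebraMap_eq (by rw [← Polynomial.coeff_map, hfσ])
  obtain ⟨g, hgf, hgd, hg⟩ := Polynomial.lifts_and_natDegree_eq_and_monic hlift hf
  rw [hfd] at hgd
  refine ⟨⟨V.card, fun i ↦ -g.coeff i⟩, rfl, fun n ↦ ?_⟩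
  have hcoeff : ∀ i, algebraMap (ZMod 4) R (g.coeff i) = f.coeff i := fun i ↦ by
    rw [← hgf, Polynomial.coeff_map]
  have hroot : ∀ v, quaternaryDFT ψ s v * f.eval (ψ (-v)) = 0 := by
    intro v
    by_cases hv : quaternaryDFT ψ s v = 0
    · rw [hv, zero_mul]
    · have : f.eval (ψ (-v)) = 0 := by
        simp only [f, Polynomial.eval_prod]
        exact Finset.prod_eq_zero (i := v) (by simp [hV, hv]) (by simp)
      rw [this, mul_zero]
  have hsum : (N : R) * algebraMap (ZMod 4) R
      (∑ i ∈ Finset.range (V.card + 1), g.coeff i * s ((n + i : ℕ) : ZMod N)) = 0 := by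
    simp only [map_sum, map_mul, hcoeff, Finset.mul_sum, mul_left_comm (N : R),
      ← inversion H hψ s]
    rw [Finset.sum_comm]
    refine Finset.sum_eq_zero fun v _ ↦ ?_
    have := congrArg (ψ (-v * n) * ·) (hroot v)
    simp only [mul_zero] at this
    rw [← this, Polynomial.eval_eq_sum_range, hfd, Finset.mul_sum, Finset.mul_sum]
    refine Finset.sum_congr rfl fun i _ ↦ ?_
    have h : ψ (-v * ((n + i : ℕ) : ZMod N)) = ψ (-v * n) * ψ (-v) ^ i := by
      rw [← AddChar.map_nsmul_eq_pow, ← AddChar.map_add_eq_mul]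
      congr 1
      push_cast [nsmul_eq_mul]
      ring
    rw [h]
    ring
  -- An odd number is its own inverse mod 4; this cancels the `N` from Fourier inversion.
  have hNN : (N : ZMod 4) * N = 1 := by
    obtain ⟨m, rfl⟩ := hN
    push_cast
    generalize (m : ZMod 4) = m
    revert m
    decide
  rw [← map_natCast (algebraMap (ZMod 4) R), ← map_mul,
    map_eq_zero_iff _ H.algebraMap_injective] at hsum
  have hsum' := congrArg ((N : ZMod 4) * ·) hsum
  simp only [← mul_assoc, hNN, one_mul, mul_zero] at hsum'
  rw [Finset.sum_range_succ, ← hgd, hg.coeff_natDegree, one_mul, hgd] at hsum'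
  refine (eq_neg_of_add_eq_zero_right hsum').trans ?_
  rw [Finset.sum_range, ← Finset.sum_neg_distrib]
  exact Finset.sum_congr rfl fun i _ ↦ (neg_mul _ _).symm

open Classical in
/-- The linear complexity of a sequence over `ZMod 4` of odd period is the number of its nonzero
Fourier coefficients. -/
theorem linearComplexity_eq (H : IsFrobeniusLift φ σ) (hN : Odd N)
    (hψ : Function.Injective fun a ↦ φ (ψ a)) (hσ : ∀ a, σ (ψ a) = ψ (2 * a))
    (s : ZMod N → ZMod 4) :
    linearComplexity (fun n : ℕ ↦ s n) =
      (Finset.univ.filter fun v ↦ quaternaryDFT ψ s v ≠ 0).card := by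
  have hmem := exists_isSolution H hN hψ hσ s
  refine le_antisymm (Nat.sInf_le hmem) (le_csInf ⟨_, hmem⟩ ?_)
  rintro L ⟨E, rfl, hE⟩
  exact card_support_le_order H hψ s E hE

end quaternaryDFT

/-! ### The quartic logarithm and its transform -/

/-- A block of four sums to 2 mod 4, so blocks of eight are needed. -/
theorem sum_range_eight_mul_zmod_four (m : ℕ) :
    ∑ n ∈ Finset.range (8 * m), (n : ZMod 4) = 0 := by
  induction m with
  | zero => simp
  | succ m ih =>
    rw [mul_add, mul_one]
    simp only [Finset.sum_range_succ, ih]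
    push_cast
    generalize (m : ZMod 4) = c
    revert c
    decide

theorem card_filter_range_four_mul (m : ℕ) (c : ZMod 4) :
    ((Finset.range (4 * m)).filter fun n : ℕ ↦ (n : ZMod 4) = c).card = m := by
  rw [Finset.card_filter]
  induction m with
  | zero => simp
  | succ m ih =>
    have h4 : (4 : ZMod 4) = 0 := by decide
    rw [mul_add, mul_one]
    simp only [Finset.sum_range_succ, ih]
    push_cast
    rw [h4, zero_mul, add_assoc, add_assoc, add_assoc]
    congr 1
    clear ih
    revert c
    decide

/-- A function `t` on `ZMod q` that is the discrete logarithm modulo four to the base `γ`, extended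
by zero. -/
structure IsQuarticLog {q : ℕ} (γ : ZMod q) (t : ZMod q → ZMod 4) : Prop where
  orderOf_eq : orderOf γ = q - 1
  map_zero : t 0 = 0
  map_pow : ∀ n : ℕ, t (γ ^ n) = n

section

variable {q : ℕ} [Fact q.Prime] {γ : ZMod q}

theorem exists_pow_eq_of_orderOf_eq (hγ : orderOf γ = q - 1) {x : ZMod q} (hx : x ≠ 0) :
    ∃ n < q - 1, γ ^ n = x := by
  have hq : 0 < q - 1 := Nat.sub_pos_of_lt (Fact.out : q.Prime).one_lt
  have : NeZero (q - 1) := ⟨hq.ne'⟩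
  exact (hγ ▸ IsPrimitiveRoot.orderOf γ).eq_pow_of_pow_eq_one (ZMod.pow_card_sub_one_eq_one hx)

theorem ne_zero_of_orderOf_eq (hγ : orderOf γ = q - 1) : γ ≠ 0 := by
  rintro rfl
  have hq : 0 < q - 1 := Nat.sub_pos_of_lt (Fact.out : q.Prime).one_lt
  have := pow_orderOf_eq_one (0 : ZMod q)
  rw [hγ, zero_pow hq.ne'] at this
  exact zero_ne_one this

theorem exists_isQuarticLog (hγ : orderOf γ = q - 1) (h4 : 4 ∣ q - 1) :
    ∃ t : ZMod q → ZMod 4, IsQuarticLog γ t := by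
  classical
  choose! f _ hf using fun x : ZMod q ↦ exists_pow_eq_of_orderOf_eq hγ (x := x)
  refine ⟨fun x ↦ if x = 0 then 0 else f x, hγ, by simp, fun n ↦ ?_⟩
  have hn : γ ^ n ≠ 0 := pow_ne_zero n (ne_zero_of_orderOf_eq hγ)
  simp only [hn, if_false]
  have hmod : f (γ ^ n) ≡ n [MOD orderOf γ] := by
    have hfin : IsOfFinOrder γ := orderOf_pos_iff.1 (hγ ▸ Nat.sub_pos_of_lt
      (Fact.out : q.Prime).one_lt)
    rw [← hfin.pow_eq_pow_iff_modEq, hf _ hn]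
  exact (ZMod.natCast_eq_natCast_iff _ _ _).2 (hmod.of_dvd (hγ ▸ h4))

end

namespace IsQuarticLog

variable {q : ℕ} [Fact q.Prime] {γ : ZMod q} {t : ZMod q → ZMod 4}

theorem map_mul (ht : IsQuarticLog γ t) {x y : ZMod q} (hx : x ≠ 0) (hy : y ≠ 0) :
    t (x * y) = t x + t y := by
  obtain ⟨m, -, rfl⟩ := exists_pow_eq_of_orderOf_eq ht.orderOf_eq hx
  obtain ⟨n, -, rfl⟩ := exists_pow_eq_of_orderOf_eq ht.orderOf_eq hy
  rw [← pow_add, ht.map_pow, ht.map_pow, ht.map_pow, Nat.cast_add]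

theorem injOn_pow (ht : IsQuarticLog γ t) :
    Set.InjOn (fun n ↦ γ ^ n) (Finset.range (q - 1) : Set ℕ) := by
  rw [← ht.orderOf_eq, Finset.coe_range]
  exact pow_injOn_Iio_orderOf

theorem filter_ne_zero_eq_image (ht : IsQuarticLog γ t) :
    (Finset.univ.filter fun x : ZMod q ↦ x ≠ 0) =
      (Finset.range (q - 1)).image fun n ↦ γ ^ n := by
  ext x
  simp only [Finset.mem_filter, Finset.mem_univ, true_and, Finset.mem_image, Finset.mem_range]
  constructor
  · exact exists_pow_eq_of_orderOf_eq ht.orderOf_eq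
  · rintro ⟨n, -, rfl⟩
    exact pow_ne_zero n (ne_zero_of_orderOf_eq ht.orderOf_eq)

theorem sum_eq_zero (ht : IsQuarticLog γ t) (h8 : 8 ∣ q - 1) : ∑ x, t x = 0 := by
  obtain ⟨m, hm⟩ := h8
  have h : ∑ x, t x = ∑ x with x ≠ 0, t x := by
    rw [Finset.sum_filter]
    refine Finset.sum_congr rfl fun x _ ↦ ?_
    split_ifs with hx
    · rfl
    · rw [not_not.1 hx, ht.map_zero]
  rw [h, ht.filter_ne_zero_eq_image, Finset.sum_image ht.injOn_pow, hm]
  simp only [ht.map_pow, sum_range_eight_mul_zmod_four]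

theorem card_fiber (ht : IsQuarticLog γ t) (h4 : 4 ∣ q - 1) (c : ZMod 4) :
    (Finset.univ.filter fun x : ZMod q ↦ x ≠ 0 ∧ t x = c).card = (q - 1) / 4 := by
  obtain ⟨m, hm⟩ := h4
  rw [← Finset.filter_filter, ht.filter_ne_zero_eq_image, Finset.filter_image,
    Finset.card_image_of_injOn (ht.injOn_pow.mono (Finset.coe_subset.2 (Finset.filter_subset _ _))), hm]
  simp only [ht.map_pow, card_filter_range_four_mul]
  omega

variable {R k : Type*} [CommRing R] [Field k] [Algebra (ZMod 4) R] {φ : R →+* k} {σ : R →+* R}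
  {χ : AddChar (ZMod q) R}

theorem quaternaryDFT_zero (ht : IsQuarticLog γ t) (h8 : 8 ∣ q - 1) :
    quaternaryDFT χ t 0 = 0 := by
  simp only [quaternaryDFT, mul_zero, AddChar.map_zero_eq_one, mul_one]
  rw [← map_sum, ht.sum_eq_zero h8, _root_.map_zero]

theorem quaternaryDFT_eq_add (H : IsFrobeniusLift φ σ) (ht : IsQuarticLog γ t)
    (hχ : Function.Injective fun a ↦ φ (χ a)) {w : ZMod q} (hw : w ≠ 0) :
    quaternaryDFT χ t w = quaternaryDFT χ t 1 + algebraMap (ZMod 4) R (t w) := by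
  -- The subtracted term corrects `b = 0`, where `t` is not additive.
  have h : ∀ b, algebraMap (ZMod 4) R (t (b * w)) * χ (b * w) =
      algebraMap (ZMod 4) R (t b) * χ (b * w) + algebraMap (ZMod 4) R (t w) * χ (b * w) -
        if b = 0 then algebraMap (ZMod 4) R (t w) else 0 := by
    intro b
    split_ifs with hb
    · simp [hb, ht.map_zero]
    · rw [ht.map_mul hb hw, map_add]
      ring
  have h1 : quaternaryDFT χ t 1 = ∑ b, algebraMap (ZMod 4) R (t (b * w)) * χ (b * w) := by
    rw [quaternaryDFT]
    simp only [mul_one]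
    exact (Fintype.sum_equiv (Equiv.mulRight₀ w hw) _ _ fun b ↦ rfl).symm
  rw [h1, Finset.sum_congr rfl fun b _ ↦ h b, Finset.sum_sub_distrib, Finset.sum_add_distrib,
    ← Finset.mul_sum, H.sum_addChar_mul hχ, if_neg hw, quaternaryDFT]
  simp

open Classical in
theorem card_quaternaryDFT_eq_zero_of_map_two_eq_zero (H : IsFrobeniusLift φ σ)
    (ht : IsQuarticLog γ t) (hχ : Function.Injective fun a ↦ φ (χ a))
    (hσ : ∀ a, σ (χ a) = χ (2 * a)) (h8 : 8 ∣ q - 1) (h20 : (2 : ZMod q) ≠ 0) (h2 : t 2 = 0) :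
    (Finset.univ.filter fun w ↦ quaternaryDFT χ t w = 0).card = (q - 1) / 4 + 1 := by
  obtain ⟨c, hc⟩ := H.exists_algebraMap_eq (x := quaternaryDFT χ t 1) (by
    rw [quaternaryDFT.map_frobenius hσ, mul_one, ht.quaternaryDFT_eq_add H hχ h20, h2,
      _root_.map_zero, add_zero])
  have hfilter : (Finset.univ.filter fun w ↦ quaternaryDFT χ t w = 0) =
      insert 0 (Finset.univ.filter fun w : ZMod q ↦ w ≠ 0 ∧ t w = -c) := by
    ext w
    simp only [Finset.mem_filter, Finset.mem_univ, true_and, Finset.mem_insert]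
    by_cases hw : w = 0
    · simp [hw, ht.quaternaryDFT_zero h8]
    · rw [ht.quaternaryDFT_eq_add H hχ hw, ← hc, ← map_add,
        map_eq_zero_iff _ H.algebraMap_injective, add_comm, add_eq_zero_iff_eq_neg]
      simp [hw]
  rw [hfilter, Finset.card_insert_of_notMem (by simp),
    ht.card_fiber (dvd_trans (by norm_num) h8)]

open Classical in
theorem card_quaternaryDFT_eq_zero_of_map_two_ne_zero (H : IsFrobeniusLift φ σ)
    (ht : IsQuarticLog γ t) (hχ : Function.Injective fun a ↦ φ (χ a))
    (hσ : ∀ a, σ (χ a) = χ (2 * a)) (h8 : 8 ∣ q - 1) (h20 : (2 : ZMod q) ≠ 0) (h2 : t 2 ≠ 0) :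
    (Finset.univ.filter fun w ↦ quaternaryDFT χ t w = 0).card = 1 := by
  rw [Finset.card_eq_one]
  refine ⟨0, ?_⟩
  ext w
  simp only [Finset.mem_filter, Finset.mem_univ, true_and, Finset.mem_singleton]
  refine ⟨fun hw ↦ by_contra fun hw0 ↦ h2 ?_, fun hw ↦ by rw [hw, ht.quaternaryDFT_zero h8]⟩
  have h := quaternaryDFT.map_frobenius hσ t w
  rw [hw, _root_.map_zero, ht.quaternaryDFT_eq_add H hχ (mul_ne_zero h20 hw0), ht.map_mul h20 hw0,
    map_add, add_left_comm, ← ht.quaternaryDFT_eq_add H hχ hw0, hw, add_zero] at h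
  exact (map_eq_zero_iff _ H.algebraMap_injective).1 h.symm

end IsQuarticLog

/-! ### Splitting the transform by the Chinese remainder theorem -/

section

variable {p q : ℕ} [Fact p.Prime] [Fact q.Prime] {R : Type*} [CommRing R]

/-- The restriction of an additive character modulo `p * q` to the first factor. -/
noncomputable def AddChar.chineseFst (hc : Nat.Coprime p q) (ψ : AddChar (ZMod (p * q)) R) :
    AddChar (ZMod p) R :=
  ψ.compAddMonoidHom ((ZMod.chineseRemainder hc).symm.toAddMonoidHom.comp
    (AddMonoidHom.inl (ZMod p) (ZMod q)))

/-- The restriction of an additive character modulo `p * q` to the second factor. -/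
noncomputable def AddChar.chineseSnd (hc : Nat.Coprime p q) (ψ : AddChar (ZMod (p * q)) R) :
    AddChar (ZMod q) R :=
  ψ.compAddMonoidHom ((ZMod.chineseRemainder hc).symm.toAddMonoidHom.comp
    (AddMonoidHom.inr (ZMod p) (ZMod q)))

theorem AddChar.chineseFst_apply (hc : Nat.Coprime p q) (ψ : AddChar (ZMod (p * q)) R)
    (a : ZMod p) : ψ.chineseFst hc a = ψ ((ZMod.chineseRemainder hc).symm (a, 0)) := rfl

theorem AddChar.chineseSnd_apply (hc : Nat.Coprime p q) (ψ : AddChar (ZMod (p * q)) R)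
    (b : ZMod q) : ψ.chineseSnd hc b = ψ ((ZMod.chineseRemainder hc).symm (0, b)) := rfl

theorem AddChar.apply_chineseRemainder_symm (hc : Nat.Coprime p q) (ψ : AddChar (ZMod (p * q)) R)
    (a : ZMod p) (b : ZMod q) :
    ψ ((ZMod.chineseRemainder hc).symm (a, b)) = ψ.chineseFst hc a * ψ.chineseSnd hc b := by
  rw [chineseFst_apply, chineseSnd_apply, ← AddChar.map_add_eq_mul, ← map_add]
  simp

variable {k : Type*} [Field k] [Algebra (ZMod 4) R] {φ : R →+* k} {σ : R →+* R}
  {t : ZMod q → ZMod 4}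

theorem quaternaryDFT_chineseRemainder_symm (H : IsFrobeniusLift φ σ) (hc : Nat.Coprime p q)
    (hp4 : p ≡ 1 [MOD 4]) {ψ : AddChar (ZMod (p * q)) R}
    (hψ : Function.Injective fun a ↦ φ (ψ a)) {s : ZMod (p * q) → ZMod 4}
    (hs : ∀ x y, s ((ZMod.chineseRemainder hc).symm (x, y)) =
      (if y = 0 then 2 else 0) + if x = 0 then 0 else t y)
    (a : ZMod p) (b : ZMod q) :
    quaternaryDFT ψ s ((ZMod.chineseRemainder hc).symm (a, b)) =
      if a = 0 then 2 else -quaternaryDFT (ψ.chineseSnd hc) t b := by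
  set χ := ψ.chineseFst hc with hχ
  set θ := ψ.chineseSnd hc with hθ
  set ι := algebraMap (ZMod 4) R with hι
  have hχinj : Function.Injective fun x ↦ φ (χ x) := fun x y hxy ↦ by
    have := (ZMod.chineseRemainder hc).symm.injective (hψ hxy)
    exact congrArg Prod.fst this
  have hp : (p : R) = 1 := by
    have h : (p : ZMod 4) = 1 := by exact_mod_cast (ZMod.natCast_eq_natCast_iff p 1 4).2 hp4
    rw [← map_natCast ι, h, map_one]
  -- Adding and subtracting the `x = 0` term makes the double sum factor.
  have hterm : ∀ x y, ι (s ((ZMod.chineseRemainder hc).symm (x, y))) *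
      ψ ((ZMod.chineseRemainder hc).symm (x, y) * (ZMod.chineseRemainder hc).symm (a, b)) =
      (if y = 0 then 2 * χ (x * a) else 0) + χ (x * a) * (ι (t y) * θ (y * b)) -
        if x = 0 then ι (t y) * θ (y * b) else 0 := by
    intro x y
    rw [← map_mul, Prod.mk_mul_mk, AddChar.apply_chineseRemainder_symm, ← hχ, ← hθ, hs, map_add]
    by_cases hx : x = 0 <;> by_cases hy : y = 0 <;>
      simp only [hx, hy, if_true, if_false, map_zero, map_ofNat, zero_mul,
        AddChar.map_zero_eq_one] <;> ring
  have hsum : quaternaryDFT ψ s ((ZMod.chineseRemainder hc).symm (a, b)) =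
      2 * ∑ x, χ (x * a) + (∑ x, χ (x * a)) * quaternaryDFT θ t b - quaternaryDFT θ t b := by
    rw [quaternaryDFT, ← (ZMod.chineseRemainder hc).symm.toEquiv.sum_comp, Fintype.sum_prod_type]
    refine (Finset.sum_congr rfl fun x _ ↦ Finset.sum_congr rfl fun y _ ↦ hterm x y).trans ?_
    simp only [Finset.sum_sub_distrib, Finset.sum_add_distrib, ← Finset.mul_sum,
      ← Finset.sum_mul]
    congr 1
    · congr 1
      simp [Finset.mul_sum]
    · rw [Finset.sum_comm]
      simp [quaternaryDFT, hι]
  rw [hsum, H.sum_addChar_mul hχinj]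
  split_ifs
  · rw [hp]; ring
  · ring

-- Every coefficient with `a = 0` is `2 ≠ 0`, so all zeros lie over the `p - 1` values `a ≠ 0`.
open Classical in
theorem linearComplexity_add_card_mul (H : IsFrobeniusLift φ σ) (hc : Nat.Coprime p q)
    (hp4 : p ≡ 1 [MOD 4]) (hodd : Odd (p * q)) {ψ : AddChar (ZMod (p * q)) R}
    (hψ : Function.Injective fun a ↦ φ (ψ a)) (hσ : ∀ a, σ (ψ a) = ψ (2 * a))
    {s : ZMod (p * q) → ZMod 4}
    (hs : ∀ x y, s ((ZMod.chineseRemainder hc).symm (x, y)) =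
      (if y = 0 then 2 else 0) + if x = 0 then 0 else t y) :
    linearComplexity (fun n : ℕ ↦ s n) + (p - 1) *
      (Finset.univ.filter fun w ↦ quaternaryDFT (ψ.chineseSnd hc) t w = 0).card = p * q := by
  rw [quaternaryDFT.linearComplexity_eq H hodd hψ hσ]
  have h20 : (2 : R) ≠ 0 := fun h ↦ by
    have := (H.two_mul_eq_zero_iff 1).1 (by rw [mul_one, h])
    rw [map_one] at this
    exact one_ne_zero this
  have hzero : (Finset.univ.filter fun v ↦ ¬ quaternaryDFT ψ s v ≠ 0) =
      ((Finset.univ.filter fun a : ZMod p ↦ a ≠ 0) ×ˢ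
        (Finset.univ.filter fun w ↦ quaternaryDFT (ψ.chineseSnd hc) t w = 0)).map
        (ZMod.chineseRemainder hc).symm.toEquiv.toEmbedding := by
    ext v
    obtain ⟨⟨a, b⟩, rfl⟩ := (ZMod.chineseRemainder hc).symm.surjective v
    have hmap : ∀ S : Finset (ZMod p × ZMod q), (ZMod.chineseRemainder hc).symm (a, b) ∈
        S.map (ZMod.chineseRemainder hc).symm.toEquiv.toEmbedding ↔ (a, b) ∈ S := fun S ↦
      Finset.mem_map' (ZMod.chineseRemainder hc).symm.toEquiv.toEmbedding
    rw [hmap, Finset.mem_filter, quaternaryDFT_chineseRemainder_symm H hc hp4 hψ hs]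
    by_cases ha : a = 0 <;> simp [ha, h20]
  have hcard : (Finset.univ.filter fun a : ZMod p ↦ a ≠ 0).card = p - 1 := by
    rw [Finset.filter_ne', Finset.card_erase_of_mem (Finset.mem_univ _), Finset.card_univ,
      ZMod.card]
  rw [← hcard, ← Finset.card_product, ← Finset.card_map
    (ZMod.chineseRemainder hc).symm.toEquiv.toEmbedding, ← hzero,
    Finset.card_filter_add_card_filter_not, Finset.card_univ, ZMod.card]

end

/-! ### Cyclotomic classes in Chinese remainder coordinates -/

namespace DingHelleseth

theorem lcm_eq_e {p q : ℕ} (hgcd : Nat.gcd (p - 1) (q - 1) = 4) : Nat.lcm (p - 1) (q - 1) = e p q := by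
  rw [Nat.lcm, hgcd, e]

theorem four_dvd_e {p q : ℕ} (hgcd : Nat.gcd (p - 1) (q - 1) = 4) : 4 ∣ e p q := by
  rw [← lcm_eq_e hgcd]
  exact (hgcd ▸ Nat.gcd_dvd_left (p - 1) (q - 1)).trans (Nat.dvd_lcm_left _ _)

variable {p q : ℕ} [Fact p.Prime] [Fact q.Prime]

theorem snd_chineseRemainder_eq_zero_iff (hc : Nat.Coprime p q) (u : ZMod (p * q)) :
    (ZMod.chineseRemainder hc u).2 = 0 ↔ u ∈ Q p q ∪ {0} := by
  constructor
  · intro h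
    rw [← ZMod.natCast_zmod_val u, map_natCast, Prod.snd_natCast, ZMod.natCast_eq_zero_iff] at h
    obtain ⟨m, hm⟩ := h
    have hlt := ZMod.val_lt u
    rw [hm, mul_comm p q] at hlt
    have hmp : m < p := lt_of_mul_lt_mul_left hlt (Nat.zero_le _)
    rcases Nat.eq_zero_or_pos m with rfl | hm0
    · exact Or.inr ((ZMod.val_eq_zero u).1 (by simpa using hm))
    · exact Or.inl ⟨m, hm0, hmp, by rw [mul_comm m, ← hm, ZMod.natCast_zmod_val]⟩
  · rintro (⟨m, -, -, rfl⟩ | rfl)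
    · rw [map_natCast, Prod.snd_natCast]
      simp
    · simp

theorem fst_chineseRemainder_eq_zero_iff (hc : Nat.Coprime p q) {u : ZMod (p * q)}
    (hu : (ZMod.chineseRemainder hc u).2 ≠ 0) :
    (ZMod.chineseRemainder hc u).1 = 0 ↔ u ∈ P p q := by
  constructor
  · intro h
    rw [← ZMod.natCast_zmod_val u, map_natCast, Prod.fst_natCast, ZMod.natCast_eq_zero_iff] at h
    obtain ⟨m, hm⟩ := h
    have hlt := ZMod.val_lt u
    rw [hm] at hlt
    have hmq : m < q := lt_of_mul_lt_mul_left hlt (Nat.zero_le _)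
    rcases Nat.eq_zero_or_pos m with rfl | hm0
    · rw [(ZMod.val_eq_zero u).1 (by simpa using hm)] at hu
      simp at hu
    · exact ⟨m, hm0, hmq, by rw [mul_comm m, ← hm, ZMod.natCast_zmod_val]⟩
  · rintro ⟨m, -, -, rfl⟩
    rw [map_natCast, Prod.fst_natCast]
    simp

/-- The generalized cyclotomic class `D_i` consists of the units modulo `p * q` whose discrete
logarithm modulo `q` is congruent to `i` modulo four. -/
theorem mem_D_iff (hc : Nat.Coprime p q) (hgcd : Nat.gcd (p - 1) (q - 1) = 4) {g h : ℤ}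
    (hgp : orderOf (g : ZMod p) = p - 1) (hhp : h ≡ g [ZMOD p]) (hhq : h ≡ 1 [ZMOD q])
    {t : ZMod q → ZMod 4} (ht : IsQuarticLog (g : ZMod q) t) {i : ℕ} (hi : i < 4)
    (u : ZMod (p * q)) :
    u ∈ D p q g h i ↔ (ZMod.chineseRemainder hc u).1 ≠ 0 ∧ (ZMod.chineseRemainder hc u).2 ≠ 0 ∧
      t (ZMod.chineseRemainder hc u).2 = i := by
  have hp : (h : ZMod p) = g := (ZMod.intCast_eq_intCast_iff _ _ _).2 hhp
  have hq : (h : ZMod q) = 1 := by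
    exact_mod_cast (ZMod.intCast_eq_intCast_iff _ _ _).2 hhq
  have hval : ∀ n j : ℕ, ZMod.chineseRemainder hc
      ((g : ZMod (p * q)) ^ n * (h : ZMod (p * q)) ^ j) =
      ((g : ZMod p) ^ (n + j), (g : ZMod q) ^ n) := by
    intro n j
    rw [map_mul, map_pow, map_pow, map_intCast, map_intCast]
    ext
    · simp [hp, pow_add]
    · simp [hq]
  have hg0 : (g : ZMod q) ≠ 0 := ne_zero_of_orderOf_eq ht.orderOf_eq
  constructor
  · rintro ⟨s, j, -, -, rfl⟩
    rw [hval]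
    refine ⟨pow_ne_zero _ (ne_zero_of_orderOf_eq hgp), pow_ne_zero _ hg0, ?_⟩
    have h4 : (4 : ZMod 4) = 0 := by decide
    rw [ht.map_pow]
    push_cast
    rw [h4, zero_mul, zero_add]
  · rintro ⟨hu1, hu2, hui⟩
    obtain ⟨α, -, hα⟩ := exists_pow_eq_of_orderOf_eq hgp hu1
    obtain ⟨β, -, hβ⟩ := exists_pow_eq_of_orderOf_eq ht.orderOf_eq hu2
    rw [← hβ, ht.map_pow, ZMod.natCast_eq_natCast_iff'] at hui
    have hd : 4 ∣ p - 1 := hgcd ▸ Nat.gcd_dvd_left _ _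
    have hdq : 4 ∣ q - 1 := hgcd ▸ Nat.gcd_dvd_right _ _
    have hp0 : 0 < p - 1 := Nat.sub_pos_of_lt (Fact.out : p.Prime).one_lt
    have hq0 : 0 < q - 1 := Nat.sub_pos_of_lt (Fact.out : q.Prime).one_lt
    have hple := Nat.le_of_dvd hp0 hd
    -- The element is `(g^(n+j), g^n)`: `j` makes `n ≡ α - j mod p - 1` and `n ≡ β mod q - 1`
    -- compatible modulo the gcd 4. Adding `p - 1 ≥ 4` avoids truncated subtraction.
    obtain ⟨j, hj, hαβ⟩ : ∃ j < 4, (α + (p - 1) - j) % 4 = β % 4 :=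
      ⟨(α + 4 - β % 4) % 4, Nat.mod_lt _ (by norm_num), by omega⟩
    let N := Nat.chineseRemainder' (n := p - 1) (m := q - 1) (a := α + (p - 1) - j) (b := β)
      (by rw [hgcd]; exact hαβ)
    have hN : (N : ℕ) < e p q :=
      lcm_eq_e hgcd ▸ Nat.chineseRemainder'_lt_lcm _ hp0.ne' hq0.ne'
    obtain ⟨n, hnp, hnq⟩ := N
    change n < e p q at hN
    have hn4 : n % 4 = i := by
      have := hnq.of_dvd hdq
      rw [Nat.ModEq, hui, Nat.mod_eq_of_lt hi] at this
      exact this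
    have he := four_dvd_e hgcd
    refine ⟨n / 4, j, by omega, hj, ?_⟩
    rw [show 4 * (n / 4) + i = n by omega]
    apply (ZMod.chineseRemainder hc).injective
    rw [hval]
    ext
    · rw [← hα]
      have hfin : IsOfFinOrder (g : ZMod p) := orderOf_pos_iff.1 (hgp ▸ hp0)
      rw [hfin.pow_eq_pow_iff_modEq, hgp]
      have h1 : n + j ≡ α + (p - 1) - j + j [MOD p - 1] := hnp.add_right j
      rw [Nat.sub_add_cancel (by omega)] at h1
      exact (h1.trans (by simp [Nat.ModEq])).symm
    · rw [← hβ]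
      have hfin : IsOfFinOrder (g : ZMod q) := orderOf_pos_iff.1 (ht.orderOf_eq ▸ hq0)
      rw [hfin.pow_eq_pow_iff_modEq, ht.orderOf_eq]
      exact hnq.symm

theorem seq_eq (hc : Nat.Coprime p q) (hgcd : Nat.gcd (p - 1) (q - 1) = 4) {g h : ℤ}
    (hgp : orderOf (g : ZMod p) = p - 1) (hhp : h ≡ g [ZMOD p]) (hhq : h ≡ 1 [ZMOD q])
    {t : ZMod q → ZMod 4} (ht : IsQuarticLog (g : ZMod q) t) (n : ℕ) :
    seq p q g h n = (if (ZMod.chineseRemainder hc (n : ZMod (p * q))).2 = 0 then 2 else 0) +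
      if (ZMod.chineseRemainder hc (n : ZMod (p * q))).1 = 0 then 0 else
        t (ZMod.chineseRemainder hc (n : ZMod (p * q))).2 := by
  rw [seq]
  generalize (n : ZMod (p * q)) = u
  have hD := fun (i : ℕ) (hi : i < 4) ↦ mem_D_iff hc hgcd hgp hhp hhq ht hi u
  simp only [← snd_chineseRemainder_eq_zero_iff hc u]
  by_cases h2 : (ZMod.chineseRemainder hc u).2 = 0
  · simp [h2, ht.map_zero]
  simp only [← fst_chineseRemainder_eq_zero_iff hc h2]
  by_cases h1 : (ZMod.chineseRemainder hc u).1 = 0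
  · simp [h1, h2]
  simp only [hD 0 (by norm_num), hD 1 (by norm_num), hD 2 (by norm_num), hD 3 (by norm_num), h1, h2,
    ne_eq, not_false_eq_true, true_and, if_false, zero_add]
  generalize t (ZMod.chineseRemainder hc u).2 = c
  revert c
  decide

end DingHelleseth

/-! ### The main theorem -/

theorem theorem2p3 (p q : ℕ) (hp : p.Prime) (hq : q.Prime) (hpq : p ≠ q)
    (hgcd : Nat.gcd (p - 1) (q - 1) = 4)
    (hq8 : q ≡ 1 [MOD 8]) (hp8 : p ≡ 5 [MOD 8])
    (g h : ℤ)
    -- `g` is a primitive root both modulo `p` and modulo `q`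
    (hgp : orderOf (g : ZMod p) = p - 1) (hgq : orderOf (g : ZMod q) = q - 1)
    (hhp : h ≡ g [ZMOD p]) (hhq : h ≡ 1 [ZMOD q]) :
    ((2 : ZMod (p * q)) ∈ DingHelleseth.D p q g h 0 ∨
      (2 : ZMod (p * q)) ∈ DingHelleseth.D p q g h 2) ∧
    ((2 : ZMod (p * q)) ∈ DingHelleseth.D p q g h 0 →
      linearComplexity (DingHelleseth.seq p q g h) = q + 3 * (p - 1) * (q - 1) / 4) ∧
    ((2 : ZMod (p * q)) ∈ DingHelleseth.D p q g h 2 →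
      linearComplexity (DingHelleseth.seq p q g h) = p * q - p + 1) := by
  have : Fact p.Prime := ⟨hp⟩
  have : Fact q.Prime := ⟨hq⟩
  have hc : Nat.Coprime p q := (Nat.coprime_primes hp hq).2 hpq
  have hq8' : q % 8 = 1 := hq8
  have hp8' : p % 8 = 5 := hp8
  have h8 : 8 ∣ q - 1 := by have := hq.one_lt; omega
  have h4 : 4 ∣ q - 1 := dvd_trans (by norm_num) h8
  have hodd : Odd (p * q) := (Nat.odd_iff.2 (by omega)).mul (Nat.odd_iff.2 (by omega))
  have two_ne : ∀ r : ℕ, r % 2 = 1 → r ≠ 1 → (2 : ZMod r) ≠ 0 := fun r hr hr1 h0 ↦ by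
    have : ((2 : ℕ) : ZMod r) = 0 := by exact_mod_cast h0
    rw [ZMod.natCast_eq_zero_iff, Nat.dvd_prime Nat.prime_two] at this
    omega
  have h2p : (2 : ZMod p) ≠ 0 := two_ne p (by omega) hp.one_lt.ne'
  have h2q : (2 : ZMod q) ≠ 0 := two_ne q (by omega) hq.one_lt.ne'
  obtain ⟨t, ht⟩ := exists_isQuarticLog hgq h4
  have hD : ∀ i < 4, (2 : ZMod (p * q)) ∈ DingHelleseth.D p q g h i ↔ t 2 = i := fun i hi ↦ by
    rw [DingHelleseth.mem_D_iff hc hgcd hgp hhp hhq ht hi, map_ofNat]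
    exact ⟨fun h ↦ h.2.2, fun h ↦ ⟨h2p, h2q, h⟩⟩
  have hD0 := hD 0 (by norm_num)
  have hD2 := hD 2 (by norm_num)
  obtain ⟨R, k, _, _, _, φ, σ, ψ, H, hψ, hσ⟩ := exists_isFrobeniusLift (p * q) hodd
  have hθ : Function.Injective fun x ↦ φ (ψ.chineseSnd hc x) := fun x y hxy ↦
    congrArg Prod.snd ((ZMod.chineseRemainder hc).symm.injective (hψ hxy))
  have hθσ : ∀ b, σ (ψ.chineseSnd hc b) = ψ.chineseSnd hc (2 * b) := fun b ↦ by
    rw [AddChar.chineseSnd_apply, AddChar.chineseSnd_apply, hσ, two_mul, two_mul, ← map_add,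
      Prod.mk_add_mk, add_zero]
  have hL := linearComplexity_add_card_mul (t := t) H hc (by unfold Nat.ModEq; omega) hodd hψ hσ
    (s := fun u ↦ (if (ZMod.chineseRemainder hc u).2 = 0 then 2 else 0) +
      if (ZMod.chineseRemainder hc u).1 = 0 then 0 else t (ZMod.chineseRemainder hc u).2)
    fun x y ↦ by simp only [RingEquiv.apply_symm_apply]
  rw [← funext (DingHelleseth.seq_eq hc hgcd hgp hhp hhq ht)] at hL
  obtain ⟨a, ha⟩ : ∃ a, p = a + 1 := ⟨p - 1, by omega⟩
  obtain ⟨b, hb⟩ : ∃ b, q = 4 * b + 1 := ⟨(q - 1) / 4, by omega⟩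
  refine ⟨?_, fun h0 ↦ ?_, fun h2 ↦ ?_⟩
  · rw [hD0, hD2]
    -- From `2 = y²` in `ZMod q`, `t 2 = 2 t y`, which is 0 or 2.
    obtain ⟨y, hy⟩ := (ZMod.exists_sq_eq_two_iff (p := q) (by omega)).2 (Or.inl hq8')
    have hy0 : y ≠ 0 := by
      rintro rfl
      exact h2q (by simpa using hy)
    rw [hy, ht.map_mul hy0 hy0]
    generalize t y = c
    revert c
    decide
  · rw [ht.card_quaternaryDFT_eq_zero_of_map_two_eq_zero H hθ hθσ h8 h2q
      (by simpa using hD0.1 h0)] at hL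
    have h1 : p - 1 = a := by omega
    have h2 : q - 1 = 4 * b := by omega
    have h3 : 3 * a * (4 * b) / 4 = 3 * a * b := by
      rw [show 3 * a * (4 * b) = 4 * (3 * a * b) by ring, Nat.mul_div_cancel_left _ (by norm_num)]
    rw [h1, h2, Nat.mul_div_cancel_left _ (by norm_num)] at hL
    rw [h1, h2, h3]
    generalize linearComplexity (DingHelleseth.seq p q g h) = L at hL ⊢
    rw [ha, hb] at hL
    rw [hb]
    linarith
  · rw [ht.card_quaternaryDFT_eq_zero_of_map_two_ne_zero H hθ hθσ h8 h2q
      (by rw [hD2.1 h2]; decide)] at hL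
    have := Nat.le_mul_of_pos_right p hq.pos
    omega
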